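/- Let $\{X(t),t\ge0\}$ be a centered Gaussian process with a.s. continuous sample paths, $X(0)=0$ a.s. and stationary increments, and let $\sigma^2(t)=\mathrm{Var}(X(t))$. Assume that $\sigma^2(\cdot)$ is differentiable, strictly increasing and convex on $[0,\infty)$. Let $c>0$, and for $u\ge0$ let $R_u(t)=u+ct-X(t)$, $t\ge0$. Let $S\in(0,\infty)$, let $u\mapsto T_u$, $u\ge 0$, be a (deterministic) bounded measurable function with $T_u>0$, and put $$\mathcal{P}_S(u,T_u)=\mathbb{P}\Big\{\inf_{t\in[0,S]}\ \sup_{s\in[t,t+T_u]}R_u(s)<0\Big\},\qquad P_S(u)=\mathbb{P}\Big\{\inf_{t\in[0,S]}R_u(t)<0\Big\}$$ (the probabilities of Parisian and of classical ruin over $[0,S]$). Then $$\lim_{u\to\infty}\frac{\log \mathcal{P}_S(u,T_u)}{u^2}=-\frac{1}{2\sigma^2(S)},$$ so that the rate does not depend on $c$, and it matches the logarithmic rate of classical ruin: $$\lim_{u\to\infty}\frac{\log \mathcal{P}_S(u,T_u)}{\log P_S(u)}=\lim_{u\to\infty}\frac{\log \mathcal{P}_S(u,T_u)}{\log \mathbb{P}\{X(S)>u\}}=1.$$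 -/

import Mathlib

open scoped NNReal

noncomputable section

namespace ParisianRuin

open MeasureTheory ProbabilityTheory

variable {Ω : Type*} [MeasurableSpace Ω]

/-- A real process indexed by `[0, ∞)` has stationary increments: for every `h ≥ 0` the processes
`(X (t + h) - X h)_t` and `(X t - X 0)_t` have the same finite-dimensional distributions. -/
def HasStationaryIncrements (X : ℝ≥0 → Ω → ℝ) (P : Measure Ω) : Prop :=
  ∀ (h : ℝ≥0) (I : Finset ℝ≥0),
    IdentDistrib (fun ω (t : I) => X ((t : ℝ≥0) + h) ω - X h ω)
      (fun ω (t : I) => X (t : ℝ≥0) ω - X 0 ω) P P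

/-- The variance function `t ↦ σ²(t) = Var (X t)`, as a function of a real variable; only its
values on `[0, ∞)` are meaningful. -/
def varianceFun (X : ℝ≥0 → Ω → ℝ) (P : Measure Ω) : ℝ → ℝ :=
  fun t => variance (X t.toNNReal) P

/-- The surplus process `R_u(t) = u + c t - X(t)` with initial capital `u` and premium rate `c`. -/
def surplus (X : ℝ≥0 → Ω → ℝ) (c : ℝ) (u : ℝ≥0) (t : ℝ≥0) (ω : Ω) : ℝ :=
  (u : ℝ) + c * (t : ℝ) - X t ω

/-- The probability of Parisian ruin over `[0, S]` with pre-specified time `T`: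
`P (inf_{t ∈ [0, S]} sup_{s ∈ [t, t + T]} R_u(s) < 0)`. -/
def parisianRuinProb (X : ℝ≥0 → Ω → ℝ) (P : Measure Ω) (c : ℝ) (S u T : ℝ≥0) : ℝ :=
  P.real {ω | (⨅ t : Set.Icc (0 : ℝ≥0) S,
    ⨆ s : Set.Icc (t : ℝ≥0) ((t : ℝ≥0) + T), surplus X c u (s : ℝ≥0) ω) < (0 : ℝ)}

/-- The classical probability of ruin over `[0, S]`: `P (inf_{t ∈ [0, S]} R_u(t) < 0)`. -/
def ruinProb (X : ℝ≥0 → Ω → ℝ) (P : Measure Ω) (c : ℝ) (S u : ℝ≥0) : ℝ :=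
  P.real {ω | (⨅ t : Set.Icc (0 : ℝ≥0) S, surplus X c u (t : ℝ≥0) ω) < (0 : ℝ)}

end ParisianRuin

end

/-! Both bounds reduce to the Gaussian tail of `X S`, at the cost of replacing `u` by `(1 ± ε) u`.

Upper bound: Parisian ruin implies classical ruin, which forces `X` above `u` somewhere on `[0, S]`
since the drift is nonnegative. Convexity with `σ²(0) = 0` gives `σ²(S / 2 ^ m) ≤ σ²(S) / 2 ^ m`, so
dyadic chaining costs at most `ε u` beyond a fixed finite grid, whose points have variance at most
`σ²(S)` (`exists_measureReal_exists_lt_le`).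

Lower bound: it suffices that `X` stays high on `[S, S + τ]`, where `τ` bounds all `T u`. Write `X s
= r s * X S + Z s` with `Z` independent of `X S`. Convexity makes `σ²` superadditive, hence `r s ≥
1`, so a large `X S` lifts the whole window up to the residual, which exceeds some `-M` with
positive probability (`exists_le_measureReal_forall_le`). The constants `M` and `c (S + τ)` are
absorbed by `ε u`. -/

namespace ParisianRuin

open MeasureTheory ProbabilityTheory Filter Topology

section GaussianTails

variable {Ω : Type*} [MeasurableSpace Ω] {P : Measure Ω} {Y : Ω → ℝ} {v : ℝ}

/-- The Chernoff bound for a centered Gaussian variable of variance at most `v`. -/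
lemma gaussian_tail_le (hY : HasGaussianLaw Y P) (hmean : ∫ ω, Y ω ∂P = 0)
    (hvar : variance Y P ≤ v) {x : ℝ} (hx : 0 ≤ x) :
    P.real {ω | x ≤ Y ω} ≤ Real.exp (-x ^ 2 / (2 * v)) := by
  have hv : 0 ≤ v := (variance_nonneg _ _).trans hvar
  have hmap := hY.map_eq_gaussianReal
  rw [hmean] at hmap
  have hsub : HasSubgaussianMGF Y v.toNNReal P := by
    refine ⟨fun t => ?_, fun t => ?_⟩
    · have h := integrable_exp_mul_gaussianReal (μ := 0) (v := (variance Y P).toNNReal) t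
      rw [← hmap] at h
      exact (integrable_map_measure (by fun_prop) hY.aemeasurable).1 h
    · rw [mgf_gaussianReal hmap, zero_mul, zero_add]
      gcongr
  have := hsub.measure_ge_le hx
  rwa [Real.coe_toNNReal _ hv] at this

/-- A lower bound for the right tail of a centered Gaussian variable. -/
lemma le_gaussian_tail (hY : HasGaussianLaw Y P) (hmean : ∫ ω, Y ω ∂P = 0)
    (hvar : variance Y P = v) (hv : 0 < v) {x : ℝ} (hx : 0 ≤ x) :
    (√(2 * Real.pi * v))⁻¹ * Real.exp (-(x + 1) ^ 2 / (2 * v)) ≤ P.real {ω | x < Y ω} := by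
  have hmap := hY.map_eq_gaussianReal
  rw [hmean, hvar] at hmap
  have hv' : v.toNNReal ≠ 0 := by simpa using hv
  have h1 : P {ω | x < Y ω} = gaussianReal 0 v.toNNReal (Set.Ioi x) := by
    rw [← hmap, Measure.map_apply_of_aemeasurable hY.aemeasurable measurableSet_Ioi]
    rfl
  rw [measureReal_def, h1, gaussianReal_apply_eq_integral _ hv', ENNReal.toReal_ofReal
    (integral_nonneg fun y => gaussianPDFReal_nonneg _ _ _)]
  calc (√(2 * Real.pi * v))⁻¹ * Real.exp (-(x + 1) ^ 2 / (2 * v))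
      = ∫ y in Set.Ioc x (x + 1),
          (√(2 * Real.pi * v))⁻¹ * Real.exp (-(x + 1) ^ 2 / (2 * v)) := by simp
    _ ≤ ∫ y in Set.Ioc x (x + 1), gaussianPDFReal 0 v.toNNReal y := by
        -- On `(x, x + 1]` with `x ≥ 0` the density is at least its value at `x + 1`.
        refine setIntegral_mono_on (integrableOn_const (by simp)) (integrable_gaussianPDFReal _ _).integrableOn
          measurableSet_Ioc fun y hy => ?_
        rw [gaussianPDFReal, Real.coe_toNNReal _ hv.le, sub_zero]
        have : y ^ 2 ≤ (x + 1) ^ 2 := by nlinarith [hy.1, hy.2]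
        gcongr
    _ ≤ ∫ y in Set.Ioi x, gaussianPDFReal 0 v.toNNReal y :=
        setIntegral_mono_set (integrable_gaussianPDFReal _ _).integrableOn
          (ae_of_all _ fun y => gaussianPDFReal_nonneg _ _ _)
          (LE.le.eventuallyLE Set.Ioc_subset_Ioi_self)

end GaussianTails

/-! ### Convex functions vanishing at the origin -/

section Convex

variable {f : ℝ → ℝ}

lemma _root_.ConvexOn.le_div_mul_of_map_zero (hf : ConvexOn ℝ (Set.Ici 0) f) (h0 : f 0 = 0)
    {s t : ℝ} (ht : 0 ≤ t) (hs : 0 < s) (hts : t ≤ s) : f t ≤ t / s * f s := by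
  have h := hf.2 (Set.mem_Ici.2 hs.le) (Set.mem_Ici.2 le_rfl) (div_nonneg ht hs.le)
    (sub_nonneg.2 ((div_le_one hs).2 hts)) (add_sub_cancel _ _)
  simpa [h0, div_mul_cancel₀ _ hs.ne'] using h

/-- Add the chord bounds from the origin at `s` and at `t`. This superadditivity is what makes the
regression coefficients at least 1. -/
lemma _root_.ConvexOn.add_le_of_map_zero (hf : ConvexOn ℝ (Set.Ici 0) f) (h0 : f 0 = 0)
    {s t : ℝ} (hs : 0 < s) (ht : 0 ≤ t) : f s + f t ≤ f (s + t) := by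
  have h1 := hf.le_div_mul_of_map_zero h0 hs.le (by linarith : 0 < s + t) (by linarith)
  have h2 := hf.le_div_mul_of_map_zero h0 ht (by linarith : 0 < s + t) (by linarith)
  have h3 : s / (s + t) * f (s + t) + t / (s + t) * f (s + t) = f (s + t) := by
    have : s + t ≠ 0 := by linarith
    field_simp
  linarith

end Convex

/-! ### Deterministic dyadic chaining -/

section Chaining

/-- The `j`-th point of the dyadic grid of `[0, S]` of level `m`. -/
noncomputable def dyadicPoint (S : ℝ≥0) (m j : ℕ) : ℝ≥0 := S * j / 2 ^ m

lemma dyadicPoint_succ_two_mul (S : ℝ≥0) (m j : ℕ) :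
    dyadicPoint S (m + 1) (2 * j) = dyadicPoint S m j := by
  simp only [dyadicPoint, pow_succ]
  push_cast
  field_simp

lemma dyadicPoint_le {S : ℝ≥0} {m j : ℕ} (h : j ≤ 2 ^ m) : dyadicPoint S m j ≤ S := by
  have : (j : ℝ≥0) ≤ 2 ^ m := by exact_mod_cast h
  unfold dyadicPoint
  rw [div_le_iff₀ (by positivity)]
  gcongr

lemma exists_tendsto_dyadicPoint {S t : ℝ≥0} (hS : 0 < S) (ht : t ≤ S) (N : ℕ) :
    ∃ j : ℕ → ℕ, (∀ k, j k ≤ 2 ^ (N + k)) ∧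
      Tendsto (fun k => dyadicPoint S (N + k) (j k)) atTop (𝓝 t) := by
  refine ⟨fun k => ⌊t / S * 2 ^ (N + k)⌋₊, fun k => ?_, ?_⟩
  · refine Nat.floor_le_of_le ?_
    push_cast
    exact mul_le_of_le_one_left (by positivity) (div_le_one_of_le₀ ht zero_le)
  · have hp : Tendsto (fun k : ℕ => (2 : ℝ≥0) ^ (N + k)) atTop atTop := by
      have := (tendsto_pow_atTop_atTop_of_one_lt (one_lt_two (α := ℝ≥0))).comp
        (tendsto_add_atTop_nat N)
      simpa [Function.comp_def, add_comm] using this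
    have h := ((tendsto_nat_floor_mul_div_atTop (R := ℝ) (a := t / S) (by positivity)).comp
      (NNReal.tendsto_coe_atTop.2 hp)).const_mul (S : ℝ)
    rw [← NNReal.tendsto_coe]
    have hS' : (S : ℝ) ≠ 0 := by exact_mod_cast hS.ne'
    rw [mul_div_cancel₀ _ hS'] at h
    refine h.congr fun k => ?_
    simp only [dyadicPoint, Function.comp_apply]
    have : ⌊(t : ℝ) / S * ((2 ^ (N + k) : ℝ≥0) : ℝ)⌋₊ = ⌊t / S * 2 ^ (N + k)⌋₊ := by
      refine Nat.floor_congr fun n => ?_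
      norm_cast
    rw [this]
    push_cast
    ring

/-- A continuous function that is at most `A` on a dyadic grid, and whose upward increments over
the finer grids are at most `a 0, a 1, …`, is at most `A + B` as soon as the partial sums of `a`
are at most `B`. -/
lemma le_of_dyadic_increments_le {S : ℝ≥0} (hS : 0 < S) {f : ℝ≥0 → ℝ} (hf : Continuous f) {N : ℕ}
    {A B : ℝ} {a : ℕ → ℝ} (ha : ∀ k, 0 ≤ a k)
    (hgrid : ∀ j ≤ 2 ^ N, f (dyadicPoint S N j) ≤ A)
    (hinc : ∀ k, ∀ j < 2 ^ (N + k), f (dyadicPoint S (N + k + 1) (2 * j + 1)) -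
      f (dyadicPoint S (N + k + 1) (2 * j)) ≤ a k)
    (hsum : ∀ k, ∑ i ∈ Finset.range k, a i ≤ B) {t : ℝ≥0} (ht : t ≤ S) : f t ≤ A + B := by
  have key : ∀ k, ∀ j ≤ 2 ^ (N + k),
      f (dyadicPoint S (N + k) j) ≤ A + ∑ i ∈ Finset.range k, a i := by
    intro k
    induction k with
    | zero => simpa using hgrid
    | succ k ih =>
      intro j hj
      rw [Finset.sum_range_succ, ← add_assoc N k 1]
      rw [← add_assoc N k 1, pow_succ] at hj
      -- Even points already lie on the coarser grid; an odd point is one increment away from its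
      -- left neighbour there.
      obtain ⟨i, rfl | rfl⟩ := j.even_or_odd'
      · rw [dyadicPoint_succ_two_mul]
        linarith [ih i (by omega), ha k]
      · have h1 := hinc k i (by omega)
        rw [dyadicPoint_succ_two_mul] at h1
        linarith [ih i (by omega)]
  obtain ⟨j, hj, hlim⟩ := exists_tendsto_dyadicPoint hS ht N
  exact le_of_tendsto ((hf.tendsto t).comp hlim)
    (Eventually.of_forall fun k => (key k _ (hj k)).trans (by linarith [hsum k]))

end Chaining

/-! ### From exponential bounds to logarithmic rates -/

section LogRate

/-- Exponential bounds from both sides determine the logarithmic rate. -/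
lemma tendsto_log_div_sq {p : ℝ≥0 → ℝ} {V : ℝ} (hV : 0 < V)
    (hlower : ∀ ε > 0, ∃ K > 0, ∀ᶠ u : ℝ≥0 in atTop,
      K * Real.exp (-((1 + ε) * u + 1) ^ 2 / (2 * V)) ≤ p u)
    (hupper : ∀ ε ∈ Set.Ioo (0 : ℝ) 1, ∃ K > 0, ∀ᶠ u : ℝ≥0 in atTop,
      p u ≤ K * Real.exp (-((1 - ε) * u) ^ 2 / (2 * V))) :
    Tendsto (fun u : ℝ≥0 => Real.log (p u) / (u : ℝ) ^ 2) atTop (𝓝 (-1 / (2 * V))) := by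
  have hu : Tendsto (fun u : ℝ≥0 => (u : ℝ)) atTop atTop :=
    NNReal.tendsto_coe_atTop.2 tendsto_id
  have hinv : Tendsto (fun u : ℝ≥0 => (u : ℝ)⁻¹) atTop (𝓝 0) := hu.inv_tendsto_atTop
  -- Positivity is needed because `Real.log 0 = 0` would break monotonicity of the logarithm.
  have hpos : ∀ᶠ u : ℝ≥0 in atTop, 0 < p u := by
    obtain ⟨K, hK, h⟩ := hlower 1 one_pos
    filter_upwards [h] with u h
    exact lt_of_lt_of_le (by positivity) h
  refine tendsto_order.2 ⟨fun b hb => ?_, fun b hb => ?_⟩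
  · have hc : Tendsto (fun ε : ℝ => -(1 + ε) ^ 2 / (2 * V)) (𝓝[>] 0) (𝓝 (-1 / (2 * V))) := by
      have : Continuous (fun ε : ℝ => -(1 + ε) ^ 2 / (2 * V)) := by fun_prop
      simpa using (this.tendsto 0).mono_left nhdsWithin_le_nhds
    obtain ⟨ε, hε, hε0⟩ := ((hc.eventually_const_lt hb).and self_mem_nhdsWithin).exists
    obtain ⟨K, hK, h⟩ := hlower ε hε0
    have hlim : Tendsto (fun u : ℝ≥0 => Real.log K * ((u : ℝ)⁻¹) ^ 2 +
        -((1 + ε) + (u : ℝ)⁻¹) ^ 2 / (2 * V)) atTop (𝓝 (-(1 + ε) ^ 2 / (2 * V))) := by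
      have : Continuous (fun y : ℝ => Real.log K * y ^ 2 + -((1 + ε) + y) ^ 2 / (2 * V)) := by
        fun_prop
      simpa [Function.comp_def] using (this.tendsto 0).comp hinv
    filter_upwards [h, hlim.eventually_const_lt hε, hu.eventually_gt_atTop 0] with u h1 h2 h3
    refine h2.trans_le ?_
    have h4 := Real.log_le_log (by positivity) h1
    rw [Real.log_mul hK.ne' (Real.exp_pos _).ne', Real.log_exp] at h4
    rw [le_div_iff₀ (by positivity)]
    refine le_trans (le_of_eq ?_) h4
    field_simp
  · have hc : Tendsto (fun ε : ℝ => -(1 - ε) ^ 2 / (2 * V)) (𝓝[>] 0) (𝓝 (-1 / (2 * V))) := by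
      have : Continuous (fun ε : ℝ => -(1 - ε) ^ 2 / (2 * V)) := by fun_prop
      simpa using (this.tendsto 0).mono_left nhdsWithin_le_nhds
    obtain ⟨ε, hε, hε0⟩ := ((hc.eventually_lt_const hb).and
      (Ioo_mem_nhdsGT (zero_lt_one (α := ℝ)))).exists
    obtain ⟨K, hK, h⟩ := hupper ε hε0
    have hlim : Tendsto (fun u : ℝ≥0 => Real.log K * ((u : ℝ)⁻¹) ^ 2 +
        -(1 - ε) ^ 2 / (2 * V)) atTop (𝓝 (-(1 - ε) ^ 2 / (2 * V))) := by
      simpa using ((hinv.pow 2).const_mul (Real.log K)).add_const (-(1 - ε) ^ 2 / (2 * V))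
    filter_upwards [h, hlim.eventually_lt_const hε, hu.eventually_gt_atTop 0, hpos]
      with u h1 h2 h3 h4
    refine lt_of_le_of_lt ?_ h2
    have h5 := Real.log_le_log h4 h1
    rw [Real.log_mul hK.ne' (Real.exp_pos _).ne', Real.log_exp] at h5
    rw [div_le_iff₀ (by positivity)]
    refine h5.trans (le_of_eq ?_)
    field_simp

lemma tendsto_log_div_log {p q : ℝ≥0 → ℝ} {L : ℝ} (hL : L ≠ 0)
    (hp : Tendsto (fun u : ℝ≥0 => Real.log (p u) / (u : ℝ) ^ 2) atTop (𝓝 L))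
    (hq : Tendsto (fun u : ℝ≥0 => Real.log (q u) / (u : ℝ) ^ 2) atTop (𝓝 L)) :
    Tendsto (fun u : ℝ≥0 => Real.log (p u) / Real.log (q u)) atTop (𝓝 1) := by
  have h := hp.div hq hL
  rw [div_self hL] at h
  refine h.congr' ?_
  filter_upwards [eventually_gt_atTop 0] with u hu
  have hu' : (u : ℝ) ^ 2 ≠ 0 := by positivity
  simp only [Pi.div_apply]
  exact div_div_div_cancel_right₀ hu' _ _

end LogRate

/-! ### Variances and covariances from stationary increments -/

section Variance

variable {Ω : Type*} [MeasurableSpace Ω] {P : Measure Ω} {X : ℝ≥0 → Ω → ℝ}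

lemma varianceFun_coe (X : ℝ≥0 → Ω → ℝ) (P : Measure Ω) (t : ℝ≥0) :
    varianceFun X P t = variance (X t) P := by
  simp [varianceFun]

lemma varianceFun_zero (hZero : ∀ᵐ ω ∂P, X 0 ω = 0) : varianceFun X P 0 = 0 := by
  have h : X 0 =ᵐ[P] 0 := hZero
  have := varianceFun_coe X P 0
  rw [NNReal.coe_zero] at this
  rw [this, variance_congr h, variance_zero]

lemma variance_increment (hZero : ∀ᵐ ω ∂P, X 0 ω = 0) (hStat : HasStationaryIncrements X P)
    {s t : ℝ≥0} (hst : s ≤ t) :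
    variance (fun ω => X t ω - X s ω) P = varianceFun X P ((t : ℝ) - s) := by
  have h := ((hStat s {t - s}).comp (measurable_pi_apply ⟨t - s, by simp⟩)).variance_eq
  simp only [Function.comp_def, tsub_add_cancel_of_le hst] at h
  rw [h, ← NNReal.coe_sub hst, varianceFun_coe]
  refine variance_congr ?_
  filter_upwards [hZero] with ω hω
  simp [hω]

lemma covariance_eq_varianceFun (hGauss : IsGaussianProcess X P)
    (hZero : ∀ᵐ ω ∂P, X 0 ω = 0) (hStat : HasStationaryIncrements X P)
    {s t : ℝ≥0} (hst : s ≤ t) :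
    covariance (X t) (X s) P =
      (varianceFun X P t + varianceFun X P s - varianceFun X P ((t : ℝ) - s)) / 2 := by
  have := hGauss.isProbabilityMeasure
  have h := variance_increment hZero hStat hst
  rw [variance_fun_sub (hGauss.hasGaussianLaw_eval t).memLp_two
    (hGauss.hasGaussianLaw_eval s).memLp_two] at h
  rw [varianceFun_coe, varianceFun_coe]
  linarith

lemma integral_increment (hGauss : IsGaussianProcess X P) (hCentered : ∀ t, ∫ ω, X t ω ∂P = 0)
    (s t : ℝ≥0) : ∫ ω, (X t ω - X s ω) ∂P = 0 := by
  have := hGauss.isProbabilityMeasure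
  rw [integral_sub ((hGauss.hasGaussianLaw_eval t).memLp_two.integrable one_le_two)
    ((hGauss.hasGaussianLaw_eval s).memLp_two.integrable one_le_two), hCentered, hCentered,
    sub_zero]

end Variance

/-! ### Upper bound for the supremum over `[0, S]` -/

section UpperBound

/-- The summand in the chaining bound at dyadic level `m` decays geometrically in `m`. -/
lemma two_pow_mul_exp_le {V u : ℝ} (hV : 0 < V) (hu : 16 * V * Real.log 4 ≤ u ^ 2) (m : ℕ) :
    2 ^ m * Real.exp (-(u * (3 / 4) ^ m) ^ 2 / (2 * (V / 2 ^ m))) ≤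
      Real.exp (-u ^ 2 / (2 * V)) / 2 ^ m := by
  have h1 : -(u * (3 / 4) ^ m) ^ 2 / (2 * (V / 2 ^ m)) = -(u ^ 2 / (2 * V)) * (9 / 8) ^ m := by
    have h2 : ((9 : ℝ) / 8) ^ m = ((3 / 4) ^ m) ^ 2 * 2 ^ m := by
      rw [← pow_mul, mul_comm m 2, pow_mul, ← mul_pow]
      norm_num
    rw [h2]
    field_simp
  -- Bernoulli leaves an excess `m u² / (16 V)` in the exponent. By `hu` it yields a factor `4 ^
  -- (-m)`: half of it pays for the `2 ^ m` intervals, half gives summability.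
  have h3 : 1 + (m : ℝ) * (1 / 8) ≤ (9 / 8) ^ m := by
    have := one_add_mul_le_pow (a := (1 / 8 : ℝ)) (by norm_num) m
    norm_num at this ⊢
    linarith
  have h4 : Real.log 4 ≤ u ^ 2 / (2 * V) * (1 / 8) := by
    rw [div_mul_eq_mul_div, le_div_iff₀ (by positivity)]
    linarith
  have h5 : -(u ^ 2 / (2 * V)) * (9 / 8) ^ m ≤ -u ^ 2 / (2 * V) + -(m * Real.log 4) := by
    have h6 : u ^ 2 / (2 * V) * (1 + m * (1 / 8)) ≤ u ^ 2 / (2 * V) * (9 / 8) ^ m := by gcongr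
    have h7 : (m : ℝ) * Real.log 4 ≤ m * (u ^ 2 / (2 * V) * (1 / 8)) := by gcongr
    rw [neg_div]
    linarith
  have h8 : Real.exp (-(m * Real.log 4)) = 1 / (2 ^ m * 2 ^ m) := by
    rw [Real.exp_neg, Real.exp_nat_mul, Real.exp_log (by norm_num), ← mul_pow, one_div]
    norm_num
  rw [h1]
  calc 2 ^ m * Real.exp (-(u ^ 2 / (2 * V)) * (9 / 8) ^ m)
      ≤ 2 ^ m * Real.exp (-u ^ 2 / (2 * V) + -(m * Real.log 4)) := by gcongr
    _ = Real.exp (-u ^ 2 / (2 * V)) / 2 ^ m := by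
      rw [Real.exp_add, h8]
      field_simp

variable {Ω : Type*} [MeasurableSpace Ω] {P : Measure Ω} {X : ℝ≥0 → Ω → ℝ}

lemma measureReal_increment_dyadic_le (hGauss : IsGaussianProcess X P)
    (hCentered : ∀ t, ∫ ω, X t ω ∂P = 0)
    (hZero : ∀ᵐ ω ∂P, X 0 ω = 0) (hStat : HasStationaryIncrements X P)
    (hConvex : ConvexOn ℝ (Set.Ici 0) (varianceFun X P))
    {S : ℝ≥0} (hS : 0 < S) (m j : ℕ) {x : ℝ} (hx : 0 ≤ x) :
    P.real {ω | x ≤ X (dyadicPoint S m (j + 1)) ω - X (dyadicPoint S m j) ω} ≤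
      Real.exp (-x ^ 2 / (2 * (varianceFun X P S / 2 ^ m))) := by
  have hle : dyadicPoint S m j ≤ dyadicPoint S m (j + 1) := by
    unfold dyadicPoint
    gcongr
    simp
  refine gaussian_tail_le hGauss.hasGaussianLaw_fun_sub
    (integral_increment hGauss hCentered _ _) ?_ hx
  rw [variance_increment hZero hStat hle]
  have hS' : (0 : ℝ) < S := by exact_mod_cast hS
  have h1 : (dyadicPoint S m (j + 1) : ℝ) - dyadicPoint S m j = S / 2 ^ m := by
    simp only [dyadicPoint]
    push_cast
    ring
  rw [h1]
  refine (hConvex.le_div_mul_of_map_zero (varianceFun_zero hZero) (by positivity) hS'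
    (div_le_self hS'.le (one_le_pow₀ one_le_two))).trans (le_of_eq ?_)
  field_simp

/-- The logarithmic upper bound for the tail of the supremum over `[0, S]`. -/
lemma exists_measureReal_exists_lt_le (hGauss : IsGaussianProcess X P)
    (hCentered : ∀ t, ∫ ω, X t ω ∂P = 0)
    (hCont : ∀ᵐ ω ∂P, Continuous (fun t : ℝ≥0 => X t ω))
    (hZero : ∀ᵐ ω ∂P, X 0 ω = 0) (hStat : HasStationaryIncrements X P)
    (hMono : StrictMonoOn (varianceFun X P) (Set.Ici 0))
    (hConvex : ConvexOn ℝ (Set.Ici 0) (varianceFun X P))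
    {S : ℝ≥0} (hS : 0 < S) {ε : ℝ} (hε : ε ∈ Set.Ioo (0 : ℝ) 1) :
    ∃ K > 0, ∀ᶠ u : ℝ≥0 in atTop, P.real {ω | ∃ t ≤ S, (u : ℝ) < X t ω} ≤
      K * Real.exp (-((1 - ε) * u) ^ 2 / (2 * varianceFun X P S)) := by
  have := hGauss.isProbabilityMeasure
  have hS' : (0 : ℝ) < S := by exact_mod_cast hS
  set V := varianceFun X P S
  have hV : 0 < V := by
    rw [← varianceFun_zero hZero]
    exact hMono (by simp) (Set.mem_Ici.2 hS'.le) hS'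
  -- The increment allowances `u (3/4) ^ (N + k + 1)` sum to `3 u (3/4) ^ N`, which must not exceed
  -- `ε u`.
  obtain ⟨N, hN⟩ := exists_pow_lt_of_lt_one (show 0 < ε / 3 by linarith [hε.1])
    (show (3 / 4 : ℝ) < 1 by norm_num)
  -- `2 ^ N + 1` grid points contribute `E` each, and all finer levels together one more `E`.
  refine ⟨2 ^ N + 1 + 1, by positivity, ?_⟩
  have hsq : Tendsto (fun u : ℝ≥0 => (u : ℝ) ^ 2) atTop atTop :=
    (tendsto_pow_atTop two_ne_zero).comp (NNReal.tendsto_coe_atTop.2 tendsto_id)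
  filter_upwards [hsq.eventually_ge_atTop (16 * V * Real.log 4)] with u hu
  set E := Real.exp (-((1 - ε) * u) ^ 2 / (2 * V)) with hE
  set A : ℕ → Set Ω := fun j => {ω | (1 - ε) * u ≤ X (dyadicPoint S N j) ω}
  set B : ℕ → ℕ → Set Ω := fun k j => {ω | (u : ℝ) * (3 / 4) ^ (N + k + 1) ≤
    X (dyadicPoint S (N + k + 1) (2 * j + 1)) ω - X (dyadicPoint S (N + k + 1) (2 * j)) ω}
  have hA : ∀ j ∈ Finset.range (2 ^ N + 1), P.real (A j) ≤ E := by
    intro j hj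
    have hjS : dyadicPoint S N j ≤ S := dyadicPoint_le (by simpa [Nat.lt_succ_iff] using hj)
    refine gaussian_tail_le (hGauss.hasGaussianLaw_eval _) (hCentered _) ?_
      (mul_nonneg (by linarith [hε.2]) u.coe_nonneg)
    rw [← varianceFun_coe]
    exact hMono.monotoneOn (Set.mem_Ici.2 (NNReal.coe_nonneg _)) (Set.mem_Ici.2 hS'.le)
      (by exact_mod_cast hjS)
  have hEle : Real.exp (-(u : ℝ) ^ 2 / (2 * V)) ≤ E := by
    rw [hE]
    have : ((1 - ε) * u) ^ 2 ≤ (u : ℝ) ^ 2 := by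
      have h1 : (1 - ε) * u ≤ u := mul_le_of_le_one_left u.coe_nonneg (by linarith [hε.1])
      have h2 : 0 ≤ (1 - ε) * u := mul_nonneg (by linarith [hε.2]) u.coe_nonneg
      gcongr
    gcongr
  have hB : ∀ k, P (⋃ j ∈ Finset.range (2 ^ (N + k)), B k j) ≤ ENNReal.ofReal (E / 2 / 2 ^ k) := by
    intro k
    rw [← ofReal_measureReal (measure_ne_top _ _)]
    refine ENNReal.ofReal_le_ofReal ?_
    calc P.real (⋃ j ∈ Finset.range (2 ^ (N + k)), B k j)
        ≤ ∑ j ∈ Finset.range (2 ^ (N + k)), P.real (B k j) := measureReal_biUnion_finset_le _ _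
      _ ≤ ∑ j ∈ Finset.range (2 ^ (N + k)),
          Real.exp (-((u : ℝ) * (3 / 4) ^ (N + k + 1)) ^ 2 / (2 * (V / 2 ^ (N + k + 1)))) :=
          Finset.sum_le_sum fun j _ => measureReal_increment_dyadic_le hGauss hCentered hZero
            hStat hConvex hS _ _ (by positivity)
      _ = 2 ^ (N + k) *
          Real.exp (-((u : ℝ) * (3 / 4) ^ (N + k + 1)) ^ 2 / (2 * (V / 2 ^ (N + k + 1)))) := by
          simp
      _ ≤ 2 ^ (N + k + 1) *
          Real.exp (-((u : ℝ) * (3 / 4) ^ (N + k + 1)) ^ 2 / (2 * (V / 2 ^ (N + k + 1)))) := by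
          exact mul_le_mul_of_nonneg_right (pow_le_pow_right₀ one_le_two (Nat.le_succ _))
            (Real.exp_pos _).le
      _ ≤ Real.exp (-(u : ℝ) ^ 2 / (2 * V)) / 2 ^ (N + k + 1) := two_pow_mul_exp_le hV hu _
      _ ≤ E / 2 ^ (k + 1) := div_le_div₀ (by positivity) hEle (by positivity)
          (pow_le_pow_right₀ one_le_two (by omega))
      _ = E / 2 / 2 ^ k := by rw [pow_succ]; field_simp
  have hsub : {ω | ∃ t ≤ S, (u : ℝ) < X t ω} ≤ᵐ[P]
      ((⋃ j ∈ Finset.range (2 ^ N + 1), A j) ∪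
        ⋃ k, ⋃ j ∈ Finset.range (2 ^ (N + k)), B k j : Set Ω) := by
    filter_upwards [hCont] with ω hω
    rintro ⟨t, ht, hlt⟩
    by_contra hcon
    have hcon' : ω ∉ ((⋃ j ∈ Finset.range (2 ^ N + 1), A j) ∪
        ⋃ k, ⋃ j ∈ Finset.range (2 ^ (N + k)), B k j : Set Ω) := hcon
    simp only [Set.mem_union, Set.mem_iUnion, not_or, not_exists, A, B, Set.mem_ofPred_eq,
      not_le, Finset.mem_range] at hcon'
    have h := le_of_dyadic_increments_le hS hω (N := N) (A := (1 - ε) * u) (B := ε * u)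
      (a := fun k => (u : ℝ) * (3 / 4) ^ (N + k + 1)) (fun k => by positivity)
      (fun j hj => (hcon'.1 j (by omega)).le) (fun k j hj => (hcon'.2 k j hj).le)
      (fun k => ?_) ht
    · linarith
    · have h1 : ∀ k : ℕ, ∑ i ∈ Finset.range k, (u : ℝ) * (3 / 4) ^ (N + i + 1) =
          3 * u * (3 / 4) ^ N * (1 - (3 / 4) ^ k) := by
        intro k
        induction k with
        | zero => simp
        | succ k ih => rw [Finset.sum_range_succ, ih]; ring
      rw [h1]
      have h2 : (1 : ℝ) - (3 / 4) ^ k ≤ 1 := by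
        have : (0 : ℝ) ≤ (3 / 4) ^ k := by positivity
        linarith
      calc 3 * (u : ℝ) * (3 / 4) ^ N * (1 - (3 / 4) ^ k) ≤ 3 * u * (3 / 4) ^ N * 1 := by gcongr
        _ ≤ 3 * u * (ε / 3) * 1 := by gcongr
        _ = ε * u := by ring
  refine ENNReal.toReal_le_of_le_ofReal (by positivity) ?_
  calc P {ω | ∃ t ≤ S, (u : ℝ) < X t ω}
      ≤ P (⋃ j ∈ Finset.range (2 ^ N + 1), A j) +
        P (⋃ k, ⋃ j ∈ Finset.range (2 ^ (N + k)), B k j) :=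
        (measure_mono_ae hsub).trans (measure_union_le _ _)
    _ ≤ ENNReal.ofReal ((2 ^ N + 1) * E) + ENNReal.ofReal E := by
        gcongr
        · rw [← ofReal_measureReal (measure_ne_top _ _)]
          refine ENNReal.ofReal_le_ofReal ?_
          refine (measureReal_biUnion_finset_le _ _).trans ((Finset.sum_le_sum hA).trans ?_)
          simp
        · refine (measure_iUnion_le _).trans ((ENNReal.tsum_le_tsum hB).trans ?_)
          rw [← ENNReal.ofReal_tsum_of_nonneg (fun k => by positivity)
            (summable_geometric_two' E), tsum_geometric_two']
    _ = ENNReal.ofReal ((2 ^ N + 1 + 1) * E) := by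
        rw [← ENNReal.ofReal_add (by positivity) (by positivity)]
        ring_nf

end UpperBound

variable {Ω : Type*} [MeasurableSpace Ω] {P : Measure Ω} {X : ℝ≥0 → Ω → ℝ}

/-! ### Lower bound by regression on `X S` -/

section LowerBound

/-- The residuals of the regression on `X S` are independent of `X S`. -/
lemma indepFun_regression (hGauss : IsGaussianProcess X P) {S : ℝ≥0}
    (hV : variance (X S) P ≠ 0) (d : ℕ → ℝ≥0) :
    IndepFun (fun ω (_ : Unit) => X S ω)
      (fun ω n => X (d n) ω - covariance (X (d n)) (X S) P / variance (X S) P * X S ω) P := by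
  have := hGauss.isProbabilityMeasure
  have hL2 : ∀ t, MemLp (X t) 2 P := fun t => (hGauss.hasGaussianLaw_eval t).memLp_two
  set r : ℕ → ℝ := fun n => covariance (X (d n)) (X S) P / variance (X S) P
  refine IsGaussianProcess.indepFun_of_covariance_eq_zero (X := fun _ : Unit => X S)
    (Y := fun n ω => X (d n) ω - r n * X S ω) ?_ (fun _ => hGauss.aemeasurable S)
    (fun n => (hGauss.aemeasurable _).sub ((hGauss.aemeasurable S).const_mul _)) ?_
  -- `X S` and the residuals are linear in `X`, hence jointly Gaussian, so zero covariance gives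
  -- independence.
  · refine hGauss.of_isGaussianProcess ?_
    rintro (_ | n)
    · exact ⟨{S}, ContinuousLinearMap.proj ⟨S, by simp⟩, fun ω => rfl⟩
    · classical
      exact ⟨{S, d n}, ContinuousLinearMap.proj ⟨d n, by simp⟩ -
        r n • ContinuousLinearMap.proj ⟨S, by simp⟩, fun ω => rfl⟩
  · intro _ n
    rw [covariance_fun_sub_right (hL2 _) (hL2 _) ((hL2 _).const_mul _),
      covariance_const_mul_right, covariance_self (hGauss.aemeasurable S), covariance_comm]
    simp only [r]
    rw [div_mul_cancel₀ _ hV, sub_self]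

/-- Over a bounded time window starting at `S` the process stays close to or above its value at
time `S` with a probability that is bounded below independently of that value. -/
lemma exists_le_measureReal_forall_le (hGauss : IsGaussianProcess X P)
    (hCentered : ∀ t, ∫ ω, X t ω ∂P = 0)
    (hCont : ∀ᵐ ω ∂P, Continuous (fun t : ℝ≥0 => X t ω))
    (hZero : ∀ᵐ ω ∂P, X 0 ω = 0) (hStat : HasStationaryIncrements X P)
    (hMono : StrictMonoOn (varianceFun X P) (Set.Ici 0))
    (hConvex : ConvexOn ℝ (Set.Ici 0) (varianceFun X P))
    {S : ℝ≥0} (hS : 0 < S) (hV : 0 < varianceFun X P S) (τ : ℝ≥0) :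
    ∃ M : ℝ, ∃ K > 0, ∀ x : ℝ, 0 ≤ x → K * Real.exp (-(x + 1) ^ 2 / (2 * varianceFun X P S)) ≤
      P.real {ω | ∀ s ∈ Set.Icc S (S + τ), x - M ≤ X s ω} := by
  have := hGauss.isProbabilityMeasure
  have hS' : (0 : ℝ) < S := by exact_mod_cast hS
  have hVvar : variance (X S) P = varianceFun X P S := (varianceFun_coe X P S).symm
  have : Nonempty (Set.Icc S (S + τ)) := ⟨⟨S, by simp⟩⟩
  -- A countable dense set makes the residual event measurable; path continuity recovers the full
  -- window.
  set d : ℕ → Set.Icc S (S + τ) := TopologicalSpace.denseSeq _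
  have hd : DenseRange d := TopologicalSpace.denseRange_denseSeq _
  set r : ℝ≥0 → ℝ := fun s => covariance (X s) (X S) P / variance (X S) P
  have hr : ∀ n, 1 ≤ r (d n) := by
    intro n
    have hle : S ≤ (d n : ℝ≥0) := (d n).2.1
    have hle' : (S : ℝ) ≤ (d n : ℝ≥0) := by exact_mod_cast hle
    simp only [r]
    rw [hVvar, one_le_div hV, covariance_eq_varianceFun hGauss hZero hStat hle]
    have h := hConvex.add_le_of_map_zero (varianceFun_zero hZero) hS' (sub_nonneg.2 hle')
    rw [add_sub_cancel] at h
    linarith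
  obtain ⟨R, hR⟩ : ∃ R, ∀ n, r (d n) ≤ R := by
    refine ⟨(varianceFun X P (S + τ : ℝ≥0) + varianceFun X P S) / 2 / varianceFun X P S,
      fun n => ?_⟩
    have hle : S ≤ (d n : ℝ≥0) := (d n).2.1
    have h1 : varianceFun X P (d n : ℝ≥0) ≤ varianceFun X P (S + τ : ℝ≥0) :=
      hMono.monotoneOn (Set.mem_Ici.2 (NNReal.coe_nonneg _)) (Set.mem_Ici.2 (NNReal.coe_nonneg _))
        (NNReal.coe_le_coe.2 (d n).2.2)
    have h2 : 0 ≤ varianceFun X P ((d n : ℝ≥0) - S : ℝ) := variance_nonneg _ _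
    simp only [r]
    rw [hVvar, covariance_eq_varianceFun hGauss hZero hStat hle]
    gcongr
    linarith
  set Z : Ω → ℕ → ℝ := fun ω n => X (d n) ω - r (d n) * X S ω
  have hind : IndepFun (fun ω (_ : Unit) => X S ω) Z P :=
    indepFun_regression hGauss (hVvar ▸ hV.ne') (fun n => d n)
  set G : ℕ → Set (ℕ → ℝ) := fun M => {z | ∀ n, -(M : ℝ) ≤ z n}
  have hGmeas : ∀ M, MeasurableSet (G M) := by
    intro M
    simp only [G, Set.ofPred_forall]
    exact MeasurableSet.iInter fun n => measurableSet_le measurable_const (measurable_pi_apply n)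
  -- Paths are bounded below on the compact window and `r ≤ R`, so almost surely some `M` works;
  -- hence one fixed `M` has positive probability.
  have hfull : P (⋃ M, Z ⁻¹' G M) = 1 := by
    rw [← measure_univ (μ := P)]
    refine measure_congr (eventuallyEq_univ.2 ?_)
    filter_upwards [hCont] with ω hω
    obtain ⟨m, hm⟩ := isCompact_range (hω.comp
      (continuous_subtype_val (p := (· ∈ Set.Icc S (S + τ))))) |>.bddBelow
    obtain ⟨M, hM⟩ := exists_nat_ge (R * |X S ω| - m)
    refine Set.mem_iUnion.2 ⟨M, fun n => ?_⟩
    have h1 : m ≤ X (d n) ω := hm ⟨d n, rfl⟩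
    have h2 : r (d n) * X S ω ≤ R * |X S ω| := by
      have h0 : 0 ≤ r (d n) := zero_le_one.trans (hr n)
      exact (mul_le_mul_of_nonneg_left (le_abs_self _) h0).trans
        (mul_le_mul_of_nonneg_right (hR n) (abs_nonneg _))
    change -(M : ℝ) ≤ X (d n) ω - r (d n) * X S ω
    linarith
  obtain ⟨M, hM⟩ : ∃ M, 0 < P.real (Z ⁻¹' G M) := by
    by_contra! hcon
    have h0 : ∀ M, P (Z ⁻¹' G M) = 0 := fun M =>
      (measureReal_eq_zero_iff (measure_ne_top _ _)).1 (le_antisymm (hcon M) measureReal_nonneg)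
    rw [measure_iUnion_null h0] at hfull
    exact zero_ne_one hfull
  refine ⟨M, (√(2 * Real.pi * varianceFun X P S))⁻¹ * P.real (Z ⁻¹' G M), by positivity,
    fun x hx => ?_⟩
  have hprod := hind.measure_inter_preimage_eq_mul (s := {y | x < y ()}) (t := G M)
    (measurableSet_lt measurable_const (measurable_pi_apply _)) (hGmeas M)
  have hsub : ((fun ω (_ : Unit) => X S ω) ⁻¹' {y | x < y ()} ∩ Z ⁻¹' G M : Set Ω) ≤ᵐ[P]
      {ω | ∀ s ∈ Set.Icc S (S + τ), x - M ≤ X s ω} := by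
    filter_upwards [hCont] with ω hω
    rintro ⟨h1, h2⟩ s hs
    have h1' : x < X S ω := h1
    have hcl : IsClosed {s : Set.Icc S (S + τ) | x - M ≤ X s ω} :=
      isClosed_le continuous_const (hω.comp continuous_subtype_val)
    refine hd.induction_on (p := fun s : Set.Icc S (S + τ) => x - M ≤ X s ω) ⟨s, hs⟩ hcl
      fun n => ?_
    have h3 : -(M : ℝ) ≤ X (d n) ω - r (d n) * X S ω := h2 n
    -- Uses `r ≥ 1` together with `X S ω > x ≥ 0`.
    have h4 : X S ω ≤ r (d n) * X S ω := le_mul_of_one_le_left (hx.trans h1'.le) (hr n)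
    linarith
  calc (√(2 * Real.pi * varianceFun X P S))⁻¹ * P.real (Z ⁻¹' G M) *
        Real.exp (-(x + 1) ^ 2 / (2 * varianceFun X P S))
      = ((√(2 * Real.pi * varianceFun X P S))⁻¹ *
          Real.exp (-(x + 1) ^ 2 / (2 * varianceFun X P S))) * P.real (Z ⁻¹' G M) := by ring
    _ ≤ P.real {ω | x < X S ω} * P.real (Z ⁻¹' G M) := by
        gcongr
        exact le_gaussian_tail (hGauss.hasGaussianLaw_eval S) (hCentered S) hVvar hV hx
    _ = P.real ((fun ω (_ : Unit) => X S ω) ⁻¹' {y | x < y ()} ∩ Z ⁻¹' G M) := by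
        rw [measureReal_def, measureReal_def, measureReal_def, hprod, ENNReal.toReal_mul]
        rfl
    _ ≤ P.real {ω | ∀ s ∈ Set.Icc S (S + τ), x - M ≤ X s ω} :=
        ENNReal.toReal_mono (measure_ne_top _ _) (measure_mono_ae hsub)

end LowerBound

/-! ### Comparison of the ruin events -/

section RuinEvents

variable {x : ℝ≥0 → ℝ}

lemma bddAbove_range_Icc (hx : Continuous x) (a b : ℝ≥0) :
    BddAbove (Set.range fun s : Set.Icc a b => x s) :=
  isCompact_range (hx.comp continuous_subtype_val) |>.bddAbove

lemma bddBelow_range_Icc (hx : Continuous x) (a b : ℝ≥0) :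
    BddBelow (Set.range fun s : Set.Icc a b => x s) :=
  isCompact_range (hx.comp continuous_subtype_val) |>.bddBelow

lemma le_iSup_Icc_add (hx : Continuous x) (t T : ℝ≥0) :
    x t ≤ ⨆ s : Set.Icc t (t + T), x s :=
  le_ciSup (bddAbove_range_Icc hx t (t + T)) ⟨t, by simp⟩

lemma iInf_Icc_le_iInf_iSup (hx : Continuous x) (S T : ℝ≥0) :
    ⨅ t : Set.Icc (0 : ℝ≥0) S, x t ≤
      ⨅ t : Set.Icc (0 : ℝ≥0) S, ⨆ s : Set.Icc (t : ℝ≥0) ((t : ℝ≥0) + T), x s :=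
  ciInf_mono (bddBelow_range_Icc hx 0 S) fun t => le_iSup_Icc_add hx t T

lemma iInf_iSup_le (hx : Continuous x) (S T : ℝ≥0) {b : ℝ}
    (hb : ∀ s ∈ Set.Icc S (S + T), x s ≤ b) :
    ⨅ t : Set.Icc (0 : ℝ≥0) S, ⨆ s : Set.Icc (t : ℝ≥0) ((t : ℝ≥0) + T), x s ≤ b := by
  -- Each window supremum dominates the value at its left endpoint, and those values are bounded
  -- below.
  have hbdd : BddBelow (Set.range fun t : Set.Icc (0 : ℝ≥0) S =>
      ⨆ s : Set.Icc (t : ℝ≥0) ((t : ℝ≥0) + T), x s) := by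
    obtain ⟨m, hm⟩ := bddBelow_range_Icc hx 0 S
    refine ⟨m, ?_⟩
    rintro _ ⟨t, rfl⟩
    exact (hm ⟨t, rfl⟩).trans (le_iSup_Icc_add hx t T)
  have : Nonempty (Set.Icc S (S + T)) := ⟨⟨S, by simp⟩⟩
  exact (ciInf_le hbdd ⟨S, by simp⟩).trans (ciSup_le fun s => hb s s.2)

lemma continuous_surplus {Ω : Type*} {X : ℝ≥0 → Ω → ℝ} {ω : Ω}
    (hω : Continuous fun t : ℝ≥0 => X t ω) (c : ℝ) (u : ℝ≥0) :
    Continuous fun t : ℝ≥0 => surplus X c u t ω := by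
  unfold surplus
  fun_prop

lemma parisianRuinProb_le_ruinProb [IsProbabilityMeasure P]
    (hCont : ∀ᵐ ω ∂P, Continuous (fun t : ℝ≥0 => X t ω)) (c : ℝ) (S u T : ℝ≥0) :
    parisianRuinProb X P c S u T ≤ ruinProb X P c S u := by
  refine ENNReal.toReal_mono (measure_ne_top _ _) (measure_mono_ae ?_)
  filter_upwards [hCont] with ω hω h
  exact (iInf_Icc_le_iInf_iSup (continuous_surplus hω c u) S T).trans_lt h

lemma ruinProb_le [IsProbabilityMeasure P] {c : ℝ} (hc : 0 ≤ c) (S u : ℝ≥0) :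
    ruinProb X P c S u ≤ P.real {ω | ∃ t ≤ S, (u : ℝ) < X t ω} := by
  refine measureReal_mono fun ω h => ?_
  have : Nonempty (Set.Icc (0 : ℝ≥0) S) := ⟨⟨0, by simp⟩⟩
  obtain ⟨t, ht⟩ := exists_lt_of_ciInf_lt (show _ < (0 : ℝ) from h)
  refine ⟨t, t.2.2, ?_⟩
  have : 0 ≤ c * ((t : ℝ≥0) : ℝ) := by positivity
  unfold surplus at ht
  linarith

lemma measureReal_forall_le_parisianRuinProb [IsProbabilityMeasure P]
    (hCont : ∀ᵐ ω ∂P, Continuous (fun t : ℝ≥0 => X t ω)) {c : ℝ} (hc : 0 ≤ c) {S u T τ : ℝ≥0}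
    (hT : T ≤ τ) {y : ℝ} (hy : u + c * (S + τ) < y) :
    P.real {ω | ∀ s ∈ Set.Icc S (S + τ), y ≤ X s ω} ≤ parisianRuinProb X P c S u T := by
  refine ENNReal.toReal_mono (measure_ne_top _ _) (measure_mono_ae ?_)
  filter_upwards [hCont] with ω hω h
  refine (iInf_iSup_le (continuous_surplus hω c u) S T (b := u + c * (S + τ) - y)
    fun s hs => ?_).trans_lt (sub_neg.2 hy)
  have hs' : s ≤ S + τ := hs.2.trans (by gcongr)
  have h1 : y ≤ X s ω := h s ⟨hs.1, hs'⟩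
  have h2 : (s : ℝ) ≤ S + τ := by exact_mod_cast hs'
  have h3 : c * (s : ℝ) ≤ c * (S + τ) := by gcongr
  unfold surplus
  linarith

end RuinEvents

end ParisianRuin

open MeasureTheory ProbabilityTheory Filter Topology ParisianRuin in
theorem theorem3p2 {Ω : Type*} [MeasurableSpace Ω] (P : MeasureTheory.Measure Ω)
    [MeasureTheory.IsProbabilityMeasure P] (X : ℝ≥0 → Ω → ℝ)
    (hGauss : ProbabilityTheory.IsGaussianProcess X P)
    (hCentered : ∀ t, ∫ ω, X t ω ∂P = 0)
    (hCont : ∀ᵐ ω ∂P, Continuous (fun t : ℝ≥0 => X t ω))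
    (hZero : ∀ᵐ ω ∂P, X 0 ω = 0)
    (hStat : ParisianRuin.HasStationaryIncrements X P)
    (hDiff : DifferentiableOn ℝ (ParisianRuin.varianceFun X P) (Set.Ici 0))
    (hMono : StrictMonoOn (ParisianRuin.varianceFun X P) (Set.Ici 0))
    (hConvex : ConvexOn ℝ (Set.Ici 0) (ParisianRuin.varianceFun X P))
    (c : ℝ) (hc : 0 < c) (S : ℝ≥0) (hS : 0 < S)
    (T : ℝ≥0 → ℝ≥0) (hTmeas : Measurable T) (hTpos : ∀ u, 0 < T u)
    (hTbdd : BddAbove (Set.range T)) :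
    Filter.Tendsto
      (fun u : ℝ≥0 => Real.log (ParisianRuin.parisianRuinProb X P c S u (T u)) / (u : ℝ) ^ 2)
      Filter.atTop (nhds (-1 / (2 * ParisianRuin.varianceFun X P S))) ∧
    Filter.Tendsto
      (fun u : ℝ≥0 => Real.log (ParisianRuin.parisianRuinProb X P c S u (T u)) /
        Real.log (ParisianRuin.ruinProb X P c S u))
      Filter.atTop (nhds 1) ∧
    Filter.Tendsto
      (fun u : ℝ≥0 => Real.log (ParisianRuin.parisianRuinProb X P c S u (T u)) /
        Real.log (P.real {ω | (u : ℝ) < X S ω}))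
      Filter.atTop (nhds 1) := by
  have hS' : (0 : ℝ) < S := by exact_mod_cast hS
  have hV : 0 < varianceFun X P S := by
    rw [← varianceFun_zero hZero]
    exact hMono (Set.mem_Ici.2 le_rfl) (Set.mem_Ici.2 hS'.le) hS'
  obtain ⟨τ, hτ⟩ := hTbdd
  have hT : ∀ u, T u ≤ τ := fun u => hτ ⟨u, rfl⟩
  have hpar_ruin : ∀ u, parisianRuinProb X P c S u (T u) ≤ ruinProb X P c S u := fun u =>
    parisianRuinProb_le_ruinProb hCont c S u (T u)
  have hlower : ∀ ε > 0, ∃ K > 0, ∀ᶠ u : ℝ≥0 in atTop,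
      K * Real.exp (-((1 + ε) * u + 1) ^ 2 / (2 * varianceFun X P S)) ≤
        parisianRuinProb X P c S u (T u) := by
    intro ε hε
    obtain ⟨M, K, hK, h⟩ := exists_le_measureReal_forall_le hGauss hCentered hCont hZero hStat
      hMono hConvex hS hV τ
    refine ⟨K, hK, ?_⟩
    have hu : Tendsto (fun u : ℝ≥0 => ε * (u : ℝ)) atTop atTop :=
      (NNReal.tendsto_coe_atTop.2 tendsto_id).const_mul_atTop hε
    filter_upwards [hu.eventually_gt_atTop (M + c * (S + τ))] with u hu
    -- Taken at `x = (1 + ε) u`: the surplus `ε u` exceeds the residual loss `M` plus the largest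
    -- drift `c (S + τ)`.
    refine (h _ (by positivity)).trans
      (measureReal_forall_le_parisianRuinProb hCont hc.le (hT u) ?_)
    linarith
  have hupper : ∀ ε ∈ Set.Ioo (0 : ℝ) 1, ∃ K > 0, ∀ᶠ u : ℝ≥0 in atTop,
      P.real {ω | ∃ t ≤ S, (u : ℝ) < X t ω} ≤
        K * Real.exp (-((1 - ε) * u) ^ 2 / (2 * varianceFun X P S)) := fun ε hε =>
    exists_measureReal_exists_lt_le hGauss hCentered hCont hZero hStat hMono hConvex hS hε
  have hpar := tendsto_log_div_sq hV hlower fun ε hε => by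
    obtain ⟨K, hK, h⟩ := hupper ε hε
    exact ⟨K, hK, h.mono fun u hu => ((hpar_ruin u).trans (ruinProb_le hc.le S u)).trans hu⟩
  have hruin := tendsto_log_div_sq (p := fun u => ruinProb X P c S u) hV
    (fun ε hε => by
      obtain ⟨K, hK, h⟩ := hlower ε hε
      exact ⟨K, hK, h.mono fun u hu => hu.trans (hpar_ruin u)⟩)
    (fun ε hε => by
      obtain ⟨K, hK, h⟩ := hupper ε hε
      exact ⟨K, hK, h.mono fun u hu => (ruinProb_le hc.le S u).trans hu⟩)
  have hmarg := tendsto_log_div_sq (p := fun u => P.real {ω | (u : ℝ) < X S ω}) hV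
    (fun ε hε => by
      refine ⟨(√(2 * Real.pi * varianceFun X P S))⁻¹, by positivity, .of_forall fun u => ?_⟩
      have hle : (u : ℝ) ≤ (1 + ε) * u := le_mul_of_one_le_left u.coe_nonneg (by linarith)
      exact (le_gaussian_tail (hGauss.hasGaussianLaw_eval S) (hCentered S)
        (varianceFun_coe X P S).symm hV (u.coe_nonneg.trans hle)).trans
        (measureReal_mono fun ω hω => hle.trans_lt hω))
    (fun ε hε => by
      obtain ⟨K, hK, h⟩ := hupper ε hε
      refine ⟨K, hK, h.mono fun u hu => le_trans (measureReal_mono ?_) hu⟩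
      exact fun ω hω => ⟨S, le_rfl, hω⟩)
  have hL : -1 / (2 * varianceFun X P S) ≠ 0 := by
    rw [neg_div]
    exact neg_ne_zero.2 (by positivity)
  exact ⟨hpar, tendsto_log_div_log hL hpar hruin, tendsto_log_div_log hL hpar hmarg⟩
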